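/- Let $0<\mu\le 1$, $-\mu<\beta\le 1-\mu$ and $\lambda>0$. Let ${}_0D_t^{\mu}$ be the Caputo derivative, ${}_0D_t^{\mu}f(t)=\frac{1}{\Gamma(1-\mu)}\int_0^t\frac{f'(\tau)}{(t-\tau)^{\mu}}\,d\tau$ for $0<\mu<1$ and ${}_0D_t^{1}f=f'$, acting on functions $f$ that are continuous on $[0,\infty)$ and $C^1$ on $(0,\infty)$ with $f'$ integrable on $(0,t)$ for every $t>0$. Let $$E(z)=E_{\mu,1+\beta/\mu,\beta/\mu}(z)=\sum_{n=0}^{\infty}z^n\prod_{k=0}^{n-1}\frac{\Gamma\left[\mu\left(k(1+\frac{\beta}{\mu})+\frac{\beta}{\mu}\right)+1\right]}{\Gamma\left[\mu\left(k(1+\frac{\beta}{\mu})+\frac{\beta}{\mu}+1\right)+1\right]}$$ be the Kilbas–Saigo function. The series converges for every $z\in\mathbb C$, $E$ is smooth on $\mathbb R$, and $x\mapsto E(-x)$ is completely monotone on $[0,\infty)$: $(-1)^n\frac{d^n}{dx^n}E(-x)\ge 0$ for all $x\ge 0$ and $n\ge 0$. Consider the system, for functions $P_{\mu,\beta}(n,\cdot)$,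 $n=0,1,2,\dots$, of the above class, $${}_0D_t^{\mu}P_{\mu,\beta}(0,t)=-\lambda t^{\beta}P_{\mu,\beta}(0,t),\qquad {}_0D_t^{\mu}P_{\mu,\beta}(n,t)=\lambda t^{\beta}\left(P_{\mu,\beta}(n-1,t)-P_{\mu,\beta}(n,t)\right)\quad(n\ge 1),\qquad t>0,$$ with the initial condition $P_{\mu,\beta}(n,0)=\delta_{n,0}$. This system has a solution, and every solution satisfies the following for all $t\ge 0$ (so the solution is unique): 1. for every $s\in\mathbb R$, $G_{\mu,\beta}(s,t):=\sum_{n=0}^\infty s^nP_{\mu,\beta}(n,t)$ converges and equals $E(\lambda t^{\mu+\beta}(s-1))$; 2. for every $n\ge 0$, $$P_{\mu,\beta}(n,t)=\frac{1}{n!}\frac{\partial^n G_{\mu,\beta}(s,t)}{\partial s^n}\Big|_{s=0}=\frac{(\lambda t^{\mu+\beta})^n}{n!}E^{(n)}(-\lambda t^{\mu+\beta})=\frac{(-z)^n}{n!}E^{(n)}(z)\Big|_{z=-\lambda t^{\mu+\beta}};$$ 3. for every $n\ge 0$, with a convergent series, $$P_{\mu,\beta}(n,t)=\frac{(\lambda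 t^{\mu+\beta})^n}{n!}\sum_{m=0}^{\infty}\frac{(m+n)!}{m!}(-\lambda t^{\mu+\beta})^m\prod_{k=0}^{m+n-1}\frac{\Gamma\left[\mu\left(k(1+\frac{\beta}{\mu})+\frac{\beta}{\mu}\right)+1\right]}{\Gamma\left[\mu\left(k(1+\frac{\beta}{\mu})+\frac{\beta}{\mu}+1\right)+1\right]};$$ 4. $P_{\mu,\beta}(n,t)\ge 0$ for every $n\ge 0$, and $\sum_{n=0}^{\infty}P_{\mu,\beta}(n,t)=1$, so that $n\mapsto P_{\mu,\beta}(n,t)$ is a probability distribution. -/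

import Mathlib

open scoped ContDiff

noncomputable section

/-- The coefficient `c_n = ∏_{j<n} Γ(α(jm+l)+1) / Γ(α(jm+l+1)+1)` (so `c_0 = 1`). -/
def kilbasSaigoCoeff (α m l : ℝ) (n : ℕ) : ℝ :=
  ∏ j ∈ Finset.range n,
    Real.Gamma (α * (j * m + l) + 1) / Real.Gamma (α * (j * m + l + 1) + 1)

/-- The Kilbas–Saigo function `E_{α,m,l}(z) = ∑ c_n z^n`, of a real or complex variable. -/
def kilbasSaigo {𝕜 : Type*} [RCLike 𝕜] (α m l : ℝ) (z : 𝕜) : 𝕜 :=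
  ∑' n : ℕ, (kilbasSaigoCoeff α m l n : 𝕜) * z ^ n

/-- The Caputo derivative of order `0 < μ ≤ 1` with lower terminal `0`; for `μ = 1`, where
the factor `1 / Γ(1 - μ)` vanishes and the integral diverges, it is the ordinary derivative. -/
def caputoDeriv (μ : ℝ) (f : ℝ → ℝ) (t : ℝ) : ℝ :=
  if μ = 1 then deriv f t
  else 1 / Real.Gamma (1 - μ) * ∫ τ in (0 : ℝ)..t, deriv f τ / (t - τ) ^ μ

/-- The functions on `[0, ∞)` whose Caputo derivative is taken: continuous on `[0, ∞)`, `C¹` on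
`(0, ∞)`, with a derivative that is integrable up to `0`. Then the integral in `caputoDeriv`
converges absolutely at every `t > 0`. -/
structure CaputoRegular (f : ℝ → ℝ) : Prop where
  continuousOn : ContinuousOn f (Set.Ici 0)
  contDiffOn : ContDiffOn ℝ 1 f (Set.Ioi 0)
  integrable_deriv : ∀ t : ℝ, 0 < t → IntervalIntegrable (deriv f) MeasureTheory.volume 0 t

/-- `P n t` solves the fractional non-homogeneous differential-difference system
`D^μ P(0,t) = -lam t^β P(0,t)`, `D^μ P(n,t) = lam t^β (P(n-1,t) - P(n,t))` for `n ≥ 1`,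
for `t > 0`, with the initial condition `P(n,0) = δ_{n,0}`. -/
structure IsCountingSolution (μ β lam : ℝ) (P : ℕ → ℝ → ℝ) : Prop where
  regular : ∀ n, CaputoRegular (P n)
  eq_zero : ∀ t : ℝ, 0 < t → caputoDeriv μ (P 0) t = -lam * t ^ β * P 0 t
  eq_succ : ∀ (n : ℕ) (t : ℝ), 0 < t →
    caputoDeriv μ (P (n + 1)) t = lam * t ^ β * (P n t - P (n + 1) t)
  init : ∀ n : ℕ, P n 0 = if n = 0 then 1 else 0

end

/-! Existence is by power series in `t ^ (μ + β)`. The Caputo derivative multiplies `t ^ p` by `Γ(p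
+ 1) / Γ(p + 1 - μ)` and lowers the exponent by `μ`. For `p = (μ + β)(k + 1)` this ratio cancels
exactly the last factor of the Kilbas–Saigo coefficient `c_{k+1}`. Expanding `(lam x)^n / n! *
E^(n)(-lam x)` in powers of `x = t ^ (μ + β)` gives binomial coefficients times `c_N`, and the
system then reduces to Pascal's rule.

Uniqueness and positivity come from an extremum principle: at a minimum over `[0, t]` attained at `t
> 0`, the Caputo derivative is nonpositive. In `D^μ f = lam t^β (g - f)` with `g ≥ 0`, a negative
minimum would make the right side positive, so `f ≥ 0` when `f 0 ≥ 0`. Induction on `n` gives `P n ≥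
0`; applied to differences of solutions, the same principle gives uniqueness.

Complete monotonicity of `E(-x)` is then a consequence: up to a positive factor, the derivatives of
`E` on the negative axis are the nonnegative solutions for `lam = 1`. The generating function is the
Taylor expansion of `E` about `-lam x`, and total mass 1 is its value at `s = 1`. -/

noncomputable section

/-! ### Entire power series: derivatives and Taylor expansion. -/

/-- The coefficient sequences of power series that converge absolutely on the whole line. -/
def EntireCoeff (a : ℕ → ℝ) : Prop :=
  ∀ x : ℝ, 0 ≤ x → Summable fun n : ℕ => |a n| * x ^ n

/-- The sum of the power series with coefficients `a`. -/
def powerSum (a : ℕ → ℝ) (x : ℝ) : ℝ := ∑' n : ℕ, a n * x ^ n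

namespace EntireCoeff

variable {a : ℕ → ℝ}

theorem summable_abs (ha : EntireCoeff a) (x : ℝ) : Summable fun n : ℕ => |a n * x ^ n| := by
  simpa [abs_mul, abs_pow] using ha |x| (abs_nonneg x)

theorem summable (ha : EntireCoeff a) (x : ℝ) : Summable fun n : ℕ => a n * x ^ n :=
  (ha.summable_abs x).of_abs

theorem of_abs_le {a' : ℕ → ℝ} {C r : ℝ} (ha : EntireCoeff a) (hr : 0 ≤ r)
    (h : ∀ n, |a' n| ≤ C * (|a n| * r ^ n)) : EntireCoeff a' := by
  intro x hx
  refine Summable.of_nonneg_of_le (fun n => by positivity) (fun n => ?_)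
    ((ha (r * x) (by positivity)).mul_left C)
  calc |a' n| * x ^ n ≤ C * (|a n| * r ^ n) * x ^ n := by gcongr; exact h n
    _ = _ := by rw [mul_pow]; ring

theorem shift (ha : EntireCoeff a) : EntireCoeff fun n => a (n + 1) := by
  intro x hx
  refine Summable.of_nonneg_of_le (fun n => by positivity) (fun n => ?_)
    ((summable_nat_add_iff 1).2 (ha (x + 1) (by positivity)))
  have : x ^ n ≤ (x + 1) ^ (n + 1) :=
    calc x ^ n ≤ (x + 1) ^ n := by gcongr; linarith
      _ ≤ (x + 1) ^ (n + 1) := pow_le_pow_right₀ (by linarith) (Nat.le_succ n)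
  gcongr

theorem derivCoeff (ha : EntireCoeff a) : EntireCoeff fun n => ((n : ℝ) + 1) * a (n + 1) := by
  refine ha.shift.of_abs_le (C := 1) (r := 2) (by norm_num) fun n => ?_
  have : (n : ℝ) + 1 ≤ 2 ^ n := by exact_mod_cast Nat.lt_two_pow_self
  rw [abs_mul, abs_of_nonneg (by positivity : (0 : ℝ) ≤ n + 1), one_mul, mul_comm]
  gcongr

theorem iterate_derivCoeff (k : ℕ) {a : ℕ → ℝ} (ha : EntireCoeff a) :
    EntireCoeff fun m => ((m + k).factorial : ℝ) / (m.factorial : ℝ) * a (m + k) := by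
  induction k generalizing a with
  | zero =>
    intro x hx
    refine (ha x hx).congr fun m => ?_
    beta_reduce
    rw [add_zero, div_self (by positivity), one_mul]
  | succ k ih =>
    intro x hx
    refine (ih ha.derivCoeff x hx).congr fun m => ?_
    beta_reduce
    rw [← add_assoc, Nat.factorial_succ (m + k)]
    push_cast
    ring_nf

theorem hasDerivAt_powerSum (ha : EntireCoeff a) (x : ℝ) :
    HasDerivAt (powerSum a) (powerSum (fun n => ((n : ℝ) + 1) * a (n + 1)) x) x := by
  -- The derived series at `|x| + 1` dominates termwise on the ball of that radius, which contains
  -- `x`.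
  have hu : Summable fun n : ℕ => |a n| * (n * (|x| + 1) ^ (n - 1)) := by
    refine (summable_nat_add_iff 1).1 ((ha.derivCoeff (|x| + 1) (by positivity)).congr fun n => ?_)
    rw [abs_mul, abs_of_nonneg (by positivity : (0 : ℝ) ≤ n + 1)]
    push_cast
    ring
  have key := hasDerivAt_tsum_of_isPreconnected (g := fun n (z : ℝ) => a n * z ^ n)
    (g' := fun n (z : ℝ) => a n * (n * z ^ (n - 1))) hu Metric.isOpen_ball
    (convex_ball (0 : ℝ) (|x| + 1)).isPreconnected
    (fun n y _ => (hasDerivAt_pow n y).const_mul _)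
    (fun n y hy => by
      rw [mem_ball_zero_iff, Real.norm_eq_abs] at hy
      rw [Real.norm_eq_abs, abs_mul, abs_mul, abs_pow, Nat.abs_cast]
      gcongr)
    (y₀ := x) (y := x) (by simp) (ha.summable x) (by simp)
  have hs : Summable fun n : ℕ => a n * (n * x ^ (n - 1)) := by
    refine (summable_nat_add_iff 1).1 ((ha.derivCoeff.summable x).congr fun n => ?_)
    push_cast
    ring
  rw [hs.tsum_eq_zero_add] at key
  simp only [Nat.cast_zero, zero_mul, mul_zero, zero_add, Nat.add_sub_cancel] at key
  refine key.congr_deriv (tsum_congr fun n => by push_cast; ring)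

theorem deriv_powerSum (ha : EntireCoeff a) :
    deriv (powerSum a) = powerSum (fun n => ((n : ℝ) + 1) * a (n + 1)) :=
  funext fun x => (ha.hasDerivAt_powerSum x).deriv

theorem continuous_powerSum (ha : EntireCoeff a) : Continuous (powerSum a) :=
  continuous_iff_continuousAt.2 fun x => (ha.hasDerivAt_powerSum x).continuousAt

theorem contDiff_nat_powerSum (k : ℕ) {a : ℕ → ℝ} (ha : EntireCoeff a) :
    ContDiff ℝ k (powerSum a) := by
  induction k generalizing a with
  | zero => exact contDiff_zero.2 ha.continuous_powerSum
  | succ k ih =>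
    push_cast
    refine contDiff_succ_iff_deriv.2
      ⟨fun x => (ha.hasDerivAt_powerSum x).differentiableAt, by simp, ?_⟩
    rw [ha.deriv_powerSum]
    exact ih ha.derivCoeff

theorem contDiff_powerSum (ha : EntireCoeff a) : ContDiff ℝ ∞ (powerSum a) :=
  contDiff_infty.2 fun k => contDiff_nat_powerSum k ha

theorem iteratedDeriv_powerSum (k : ℕ) {a : ℕ → ℝ} (ha : EntireCoeff a) :
    iteratedDeriv k (powerSum a) =
      powerSum fun m => ((m + k).factorial : ℝ) / (m.factorial : ℝ) * a (m + k) := by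
  induction k generalizing a with
  | zero =>
    simp only [iteratedDeriv_zero, add_zero]
    congr 1
    funext m
    rw [div_self (by positivity), one_mul]
  | succ k ih =>
    rw [iteratedDeriv_succ', ha.deriv_powerSum, ih ha.derivCoeff]
    congr 1
    funext m
    rw [← add_assoc, Nat.factorial_succ (m + k)]
    push_cast
    ring

theorem powerSum_zero (a : ℕ → ℝ) : powerSum a 0 = a 0 := by
  rw [powerSum, tsum_eq_single 0 fun n hn => by simp [hn]]
  simp

/-- The binomial theorem makes the right side a sum over antidiagonals of a double series. The
series at `|y| + |x|` gives absolute convergence, so the sum may be taken by rows instead. -/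
theorem hasSum_taylor (ha : EntireCoeff a) (x y : ℝ) :
    HasSum (fun n : ℕ => y ^ n / (n.factorial : ℝ) *
      ∑' m : ℕ, ((m + n).factorial : ℝ) / (m.factorial : ℝ) * a (m + n) * x ^ m)
      (powerSum a (x + y)) := by
  let F : ℕ × ℕ → ℝ := fun p => a (p.1 + p.2) * (y ^ p.1 * x ^ p.2 * (p.1 + p.2).choose p.1)
  have hbin (u v : ℝ) (N : ℕ) :
      ∑ p ∈ Finset.HasAntidiagonal.antidiagonal N, u ^ p.1 * v ^ p.2 * ((p.1 + p.2).choose p.1 : ℝ) =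
        (u + v) ^ N := by
    rw [(Commute.all u v).add_pow']
    refine Finset.sum_congr rfl fun p hp => ?_
    rw [Finset.HasAntidiagonal.mem_antidiagonal.1 hp, nsmul_eq_mul, mul_comm]
  have hF : Summable F := by
    refine Summable.of_abs ?_
    rw [← Finset.HasAntidiagonal.sigmaAntidiagonalEquivProd.summable_iff]
    refine (summable_sigma_of_nonneg fun _ => abs_nonneg _).2 ⟨fun N => (hasSum_fintype _).summable, ?_⟩
    refine (ha (|y| + |x|) (by positivity)).congr fun N => ?_
    rw [tsum_fintype, ← hbin, Finset.mul_sum, ← Finset.sum_attach]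
    refine Finset.sum_congr rfl fun p _ => ?_
    simp only [F, Finset.HasAntidiagonal.sigmaAntidiagonalEquivProd_apply,
      abs_mul, abs_pow, Nat.abs_cast]
    rw [Finset.HasAntidiagonal.mem_antidiagonal.1 p.2]
  have h1 : HasSum F (powerSum a (x + y)) := by
    rw [← Finset.HasAntidiagonal.sigmaAntidiagonalEquivProd.hasSum_iff]
    have hs := (Finset.HasAntidiagonal.sigmaAntidiagonalEquivProd.summable_iff.2 hF)
    convert hs.hasSum using 1
    rw [hs.tsum_sigma, powerSum]
    refine tsum_congr fun N => ?_
    rw [tsum_fintype, add_comm x y, ← hbin, Finset.mul_sum, ← Finset.sum_attach]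
    refine Finset.sum_congr rfl fun p _ => ?_
    simp only [F, Function.comp, Finset.HasAntidiagonal.sigmaAntidiagonalEquivProd_apply]
    rw [Finset.HasAntidiagonal.mem_antidiagonal.1 p.2]
  convert h1.prod_fiberwise fun n => (hF.prod_factor n).hasSum using 2 with n
  rw [← tsum_mul_left]
  refine tsum_congr fun m => ?_
  simp only [F]
  rw [add_comm n m, Nat.add_comm m n, Nat.cast_add_choose, Nat.add_comm n m]
  field_simp

end EntireCoeff

/-! ### Gamma ratios and growth of the Kilbas–Saigo coefficients. -/

/-- Log-convexity of `Γ` between `y + μ` and `y + μ + 1` bounds `Γ(y + 1)` by `Γ(y + μ) (y + μ)^(1 -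
μ)`; then `y + μ ≤ 2y`. -/
theorem Gamma_div_Gamma_add_le {μ y : ℝ} (hμ : 0 < μ) (hμ1 : μ ≤ 1) (hy : 1 ≤ y) :
    Real.Gamma y / Real.Gamma (y + μ) ≤ 2 * y ^ (-μ) := by
  have hy0 : 0 < y := by linarith
  have hG : 0 < Real.Gamma (y + μ) := Real.Gamma_pos_of_pos (by linarith)
  have h1 : Real.Gamma (y + 1) ≤ Real.Gamma (y + μ) * (y + μ) ^ (1 - μ) := by
    rcases hμ1.eq_or_lt with rfl | hlt
    · simp
    have h := Real.Gamma_mul_add_mul_le_rpow_Gamma_mul_rpow_Gamma (s := y + μ) (t := y + μ + 1)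
      (a := μ) (b := 1 - μ) (by linarith) (by linarith) hμ (by linarith) (by ring)
    rw [show μ * (y + μ) + (1 - μ) * (y + μ + 1) = y + 1 by ring,
      Real.Gamma_add_one (by linarith : y + μ ≠ 0).symm.symm,
      Real.mul_rpow (by linarith) hG.le] at h
    calc _ ≤ _ := h
      _ = Real.Gamma (y + μ) ^ (μ + (1 - μ)) * (y + μ) ^ (1 - μ) := by
        rw [Real.rpow_add hG]; ring
      _ = _ := by rw [add_sub_cancel, Real.rpow_one]
  have h2 : (y + μ) ^ (1 - μ) ≤ 2 * y ^ (1 - μ) :=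
    calc (y + μ) ^ (1 - μ) ≤ (2 * y) ^ (1 - μ) :=
          Real.rpow_le_rpow (by linarith) (by linarith) (by linarith)
      _ = 2 ^ (1 - μ) * y ^ (1 - μ) := Real.mul_rpow (by norm_num) hy0.le
      _ ≤ 2 ^ (1 : ℝ) * y ^ (1 - μ) := by
          gcongr
          · norm_num
          · linarith
      _ = _ := by rw [Real.rpow_one]
  rw [Real.Gamma_add_one hy0.ne'] at h1
  rw [div_le_iff₀ hG]
  have h3 : y ^ (1 - μ) = y * y ^ (-μ) := by
    rw [sub_eq_add_neg, Real.rpow_add hy0, Real.rpow_one]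
  rw [h3] at h2
  refine le_of_mul_le_mul_left ?_ hy0
  calc y * Real.Gamma y ≤ _ := h1
    _ ≤ Real.Gamma (y + μ) * (2 * (y * y ^ (-μ))) := by gcongr
    _ = _ := by ring

section Coefficients

variable {μ β : ℝ}

theorem kilbasSaigoCoeff_eq_prod (hμ : μ ≠ 0) (n : ℕ) :
    kilbasSaigoCoeff μ (1 + β / μ) (β / μ) n = ∏ j ∈ Finset.range n,
      Real.Gamma ((μ + β) * (j + 1 : ℝ) + 1 - μ) / Real.Gamma ((μ + β) * (j + 1 : ℝ) + 1) := by
  refine Finset.prod_congr rfl fun j _ => ?_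
  congr 2 <;> field_simp <;> ring

theorem kilbasSaigoCoeff_zero (α m l : ℝ) : kilbasSaigoCoeff α m l 0 = 1 := by
  simp [kilbasSaigoCoeff]

theorem kilbasSaigoCoeff_succ (hμ : μ ≠ 0) (n : ℕ) :
    kilbasSaigoCoeff μ (1 + β / μ) (β / μ) (n + 1) = kilbasSaigoCoeff μ (1 + β / μ) (β / μ) n *
      (Real.Gamma ((μ + β) * (n + 1 : ℝ) + 1 - μ) / Real.Gamma ((μ + β) * (n + 1 : ℝ) + 1)) := by
  rw [kilbasSaigoCoeff_eq_prod hμ, kilbasSaigoCoeff_eq_prod hμ, Finset.prod_range_succ]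

theorem kilbasSaigoCoeff_pos (hμ : 0 < μ) (hμ1 : μ ≤ 1) (hβ : -μ < β) (n : ℕ) :
    0 < kilbasSaigoCoeff μ (1 + β / μ) (β / μ) n := by
  rw [kilbasSaigoCoeff_eq_prod hμ.ne']
  refine Finset.prod_pos fun j _ => ?_
  have : 0 < (μ + β) * (j + 1 : ℝ) := mul_pos (by linarith) (by positivity)
  exact div_pos (Real.Gamma_pos_of_pos (by linarith)) (Real.Gamma_pos_of_pos (by linarith))

/-- Ratio test: the quotient of consecutive coefficients is `O(n ^ (-μ))`. -/
theorem entireCoeff_kilbasSaigoCoeff (hμ : 0 < μ) (hμ1 : μ ≤ 1) (hβ : -μ < β) :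
    EntireCoeff (kilbasSaigoCoeff μ (1 + β / μ) (β / μ)) := by
  have hpos := kilbasSaigoCoeff_pos hμ hμ1 hβ
  have hlin : Filter.Tendsto (fun n : ℕ => (μ + β) * (n + 1 : ℝ) + 1 - μ)
      Filter.atTop Filter.atTop := by
    have h : Filter.Tendsto (fun n : ℕ => (μ + β) * (n + 1 : ℝ)) Filter.atTop Filter.atTop :=
      (Filter.tendsto_atTop_add_const_right _ 1 tendsto_natCast_atTop_atTop).const_mul_atTop
        (by linarith)
    refine (Filter.tendsto_atTop_add_const_right _ (1 - μ) h).congr fun n => by ring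
  have hratio : Filter.Tendsto (fun n : ℕ => Real.Gamma ((μ + β) * (n + 1 : ℝ) + 1 - μ) /
      Real.Gamma ((μ + β) * (n + 1 : ℝ) + 1)) Filter.atTop (nhds 0) := by
    have hb := ((tendsto_rpow_neg_atTop hμ).comp hlin).const_mul 2
    rw [mul_zero] at hb
    refine squeeze_zero' (Filter.Eventually.of_forall fun n => ?_) ?_ hb
    · have : 0 < (μ + β) * (n + 1 : ℝ) := mul_pos (by linarith) (by positivity)
      exact (div_pos (Real.Gamma_pos_of_pos (by linarith))
        (Real.Gamma_pos_of_pos (by linarith))).le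
    · filter_upwards [hlin.eventually_ge_atTop 1] with n hn
      have := Gamma_div_Gamma_add_le hμ hμ1 hn
      rwa [sub_add_cancel] at this
  have hmain (x : ℝ) (hx : 0 < x) :
      Summable fun n => |kilbasSaigoCoeff μ (1 + β / μ) (β / μ) n| * x ^ n := by
    refine summable_of_ratio_test_tendsto_lt_one (l := 0) one_pos
      (Filter.Eventually.of_forall fun n => ?_) ?_
    · have := (hpos n).ne'
      positivity
    · have := hratio.mul_const x
      rw [zero_mul] at this
      refine this.congr fun n => ?_
      have hr : 0 < (μ + β) * (n + 1 : ℝ) := mul_pos (by linarith) (by positivity)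
      have hr' := div_pos (Real.Gamma_pos_of_pos (by linarith : 0 < (μ + β) * (n + 1 : ℝ) + 1 - μ))
        (Real.Gamma_pos_of_pos (by linarith : 0 < (μ + β) * (n + 1 : ℝ) + 1))
      have h0 := hpos n
      rw [kilbasSaigoCoeff_succ hμ.ne', abs_of_pos (mul_pos h0 hr'), abs_of_pos h0,
        Real.norm_of_nonneg (by positivity), Real.norm_of_nonneg (by positivity), pow_succ]
      generalize kilbasSaigoCoeff μ (1 + β / μ) (β / μ) n = c at h0
      field_simp
  intro x hx
  -- The ratio test needs nonzero terms, so `x = 0` is reached by comparison with `x + 1`.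
  refine Summable.of_nonneg_of_le (fun n => by positivity) (fun n => ?_) (hmain (x + 1) (by linarith))
  gcongr
  linarith

end Coefficients
end

/-! ### Extremum and comparison principles for the Caputo derivative. -/

noncomputable section

open MeasureTheory Set Filter Topology

theorem intervalIntegrable_sub_rpow_neg {μ : ℝ} (hμ1 : μ < 1) (t a b : ℝ) :
    IntervalIntegrable (fun τ => (t - τ) ^ (-μ)) volume a b := by
  simpa using (intervalIntegral.intervalIntegrable_rpow' (a := t - a) (b := t - b)
    (by linarith : -1 < -μ)).comp_sub_left t

namespace CaputoRegular

variable {f g : ℝ → ℝ}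

theorem continuousOn_deriv (hf : CaputoRegular f) : ContinuousOn (deriv f) (Ioi 0) :=
  hf.contDiffOn.continuousOn_deriv_of_isOpen isOpen_Ioi le_rfl

theorem hasDerivAt (hf : CaputoRegular f) {t : ℝ} (ht : 0 < t) : HasDerivAt f (deriv f t) t :=
  ((hf.contDiffOn.differentiableOn one_ne_zero).differentiableAt (Ioi_mem_nhds ht)).hasDerivAt

/-- The possible singularities, of `deriv f` at `0` and of the kernel at `t`, are separated by
splitting at `t / 2`. -/
theorem intervalIntegrable_deriv_div (hf : CaputoRegular f) {μ : ℝ} (hμ1 : μ < 1)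
    {t : ℝ} (ht : 0 < t) :
    IntervalIntegrable (fun τ => deriv f τ / (t - τ) ^ μ) volume 0 t := by
  have hle : ∀ a b : ℝ, 0 ≤ a → a ≤ b → b ≤ t →
      IntervalIntegrable (fun τ => deriv f τ * (t - τ) ^ (-μ)) volume a b →
      IntervalIntegrable (fun τ => deriv f τ / (t - τ) ^ μ) volume a b := by
    intro a b ha hab hb h
    refine h.congr fun τ hτ => ?_
    rw [uIoc_of_le hab] at hτ
    rw [Real.rpow_neg (by linarith [hτ.2]), div_eq_mul_inv]
  refine (hle 0 (t / 2) le_rfl (by linarith) (by linarith) ?_).trans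
    (hle (t / 2) t (by linarith) (by linarith) le_rfl ?_)
  · refine (hf.integrable_deriv _ (by linarith)).mul_continuousOn fun τ hτ => ?_
    rw [uIcc_of_le (by linarith)] at hτ
    exact ((continuousAt_const.sub continuousAt_id).rpow_const
      (Or.inl (sub_pos.2 (show τ < t by linarith [hτ.2])).ne')).continuousWithinAt
  · refine (intervalIntegrable_sub_rpow_neg hμ1 t _ _).continuousOn_mul
      (hf.continuousOn_deriv.mono fun τ hτ => ?_)
    rw [uIcc_of_le (by linarith)] at hτ
    exact lt_of_lt_of_le (by linarith) hτ.1

theorem sub (hf : CaputoRegular f) (hg : CaputoRegular g) :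
    CaputoRegular fun t => f t - g t where
  continuousOn := hf.continuousOn.sub hg.continuousOn
  contDiffOn := hf.contDiffOn.sub hg.contDiffOn
  integrable_deriv t ht := by
    refine ((hf.integrable_deriv t ht).sub (hg.integrable_deriv t ht)).congr fun τ hτ => ?_
    rw [uIoc_of_le ht.le] at hτ
    exact ((hf.hasDerivAt hτ.1).sub (hg.hasDerivAt hτ.1)).deriv.symm

theorem caputoDeriv_sub (hf : CaputoRegular f) (hg : CaputoRegular g) {μ : ℝ} (hμ1 : μ ≤ 1)
    {t : ℝ} (ht : 0 < t) :
    caputoDeriv μ (fun t => f t - g t) t = caputoDeriv μ f t - caputoDeriv μ g t := by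
  have hd : ∀ τ, 0 < τ → deriv (fun t => f t - g t) τ = deriv f τ - deriv g τ := fun τ hτ =>
    ((hf.hasDerivAt hτ).sub (hg.hasDerivAt hτ)).deriv
  unfold caputoDeriv
  split_ifs with h
  · exact hd t ht
  · have hμ : μ < 1 := lt_of_le_of_ne hμ1 h
    rw [← mul_sub, ← intervalIntegral.integral_sub (hf.intervalIntegrable_deriv_div hμ ht)
      (hg.intervalIntegrable_deriv_div hμ ht)]
    congr 1
    refine intervalIntegral.integral_congr_ae (Eventually.of_forall fun τ hτ => ?_)
    rw [uIoc_of_le ht.le] at hτ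
    rw [hd τ hτ.1, sub_div]

/-- Integrate by parts with `f - f t`, stopping at `x < t` to avoid the singular kernel. Minimality
gives the boundary term at `0` and the remaining integral the favourable sign. -/
theorem integral_deriv_div_le (hf : CaputoRegular f) {μ : ℝ} (hμ : 0 < μ) {t x : ℝ}
    (hx : 0 < x) (hxt : x < t) (hmin : ∀ s ∈ Icc 0 t, f t ≤ f s) :
    ∫ τ in (0 : ℝ)..x, deriv f τ / (t - τ) ^ μ ≤ (f x - f t) * (t - x) ^ (-μ) := by
  have hpos : ∀ τ ∈ uIcc 0 x, 0 < t - τ := fun τ hτ => by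
    rw [uIcc_of_le hx.le] at hτ
    linarith [hτ.2]
  have hcont : ∀ p : ℝ, ContinuousOn (fun τ => (t - τ) ^ p) (uIcc 0 x) := fun p =>
    (continuousOn_const.sub continuousOn_id).rpow_const fun τ hτ => Or.inl (hpos τ hτ).ne'
  have hfc : ContinuousOn (fun τ => f τ - f t) (uIcc 0 x) := by
    rw [uIcc_of_le hx.le]
    exact (hf.continuousOn.mono Icc_subset_Ici_self).sub continuousOn_const
  have hv' : ContinuousOn (fun τ => μ * (t - τ) ^ (-μ - 1)) (uIcc 0 x) :=
    continuousOn_const.mul (hcont _)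
  have hd := hf.integrable_deriv x hx
  have key := intervalIntegral.integral_deriv_mul_eq_sub_of_hasDeriv_right (a := 0) (b := x)
    (u := fun τ => f τ - f t) (u' := deriv f) (v := fun τ => (t - τ) ^ (-μ))
    (v' := fun τ => μ * (t - τ) ^ (-μ - 1)) hfc (hcont _)
    (fun τ hτ => by
      rw [min_eq_left hx.le] at hτ
      exact ((hf.hasDerivAt hτ.1).sub_const _).hasDerivWithinAt)
    (fun τ hτ => by
      have h0 : t - τ ≠ 0 := (hpos τ (Ioo_subset_Icc_self hτ)).ne'
      have h1 := (((hasDerivAt_id τ).const_sub t).rpow_const (p := -μ) (Or.inl h0))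
      exact (h1.congr_deriv (by simp)).hasDerivWithinAt)
    hd hv'.intervalIntegrable
  have hi : IntervalIntegrable (fun τ => (f τ - f t) * (μ * (t - τ) ^ (-μ - 1))) volume 0 x :=
    (hfc.mul hv').intervalIntegrable
  rw [intervalIntegral.integral_add (hd.mul_continuousOn (hcont _)) hi] at key
  have h1 : 0 ≤ ∫ τ in (0 : ℝ)..x, (f τ - f t) * (μ * (t - τ) ^ (-μ - 1)) := by
    refine intervalIntegral.integral_nonneg hx.le fun τ hτ => ?_
    have h2 := hmin τ ⟨hτ.1, by linarith [hτ.2]⟩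
    have h3 : 0 < t - τ := by linarith [hτ.2]
    exact mul_nonneg (by linarith) (by positivity)
  have h2 : 0 ≤ (f 0 - f t) * (t - 0) ^ (-μ) := by
    have h2 := hmin 0 ⟨le_rfl, by linarith⟩
    have h3 : 0 < t - 0 := by linarith
    exact mul_nonneg (by linarith) (by positivity)
  have h3 : ∫ τ in (0 : ℝ)..x, deriv f τ / (t - τ) ^ μ =
      ∫ τ in (0 : ℝ)..x, deriv f τ * (t - τ) ^ (-μ) := by
    refine intervalIntegral.integral_congr fun τ hτ => ?_
    rw [Real.rpow_neg (hpos τ hτ).le, div_eq_mul_inv]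
  rw [h3]
  linarith

/-- Let `x → t` in the previous bound: differentiability of `f` at `t` makes the boundary term `O((t
- x) ^ (1 - μ))`. -/
theorem integral_deriv_div_nonpos (hf : CaputoRegular f) {μ : ℝ} (hμ : 0 < μ) (hμ1 : μ < 1)
    {t : ℝ} (ht : 0 < t) (hmin : ∀ s ∈ Icc 0 t, f t ≤ f s) :
    ∫ τ in (0 : ℝ)..t, deriv f τ / (t - τ) ^ μ ≤ 0 := by
  have hint := hf.intervalIntegrable_deriv_div hμ1 ht
  have hev : ∀ᶠ x in 𝓝[<] t, x ∈ Ioo 0 t := Ioo_mem_nhdsLT ht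
  have h1 : Tendsto (fun x => ∫ τ in (0 : ℝ)..x, deriv f τ / (t - τ) ^ μ) (𝓝[<] t)
      (𝓝 (∫ τ in (0 : ℝ)..t, deriv f τ / (t - τ) ^ μ)) := by
    have hc := intervalIntegral.continuousOn_primitive_interval' hint left_mem_uIcc
    rw [uIcc_of_le ht.le] at hc
    refine (hc t (right_mem_Icc.2 ht.le)).mono_left (nhdsWithin_le_of_mem ?_)
    filter_upwards [hev] with x hx using Ioo_subset_Icc_self hx
  have h2 : Tendsto (fun x => (f x - f t) * (t - x) ^ (-μ)) (𝓝[<] t) (𝓝 0) := by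
    have hs : Tendsto (slope f t) (𝓝[<] t) (𝓝 (deriv f t)) :=
      (hasDerivAt_iff_tendsto_slope.1 (hf.hasDerivAt ht)).mono_left
        (nhdsWithin_mono _ fun x (hx : x < t) => hx.ne)
    have hp : Tendsto (fun x => (t - x) ^ (1 - μ)) (𝓝[<] t) (𝓝 0) := by
      have : ContinuousAt (fun x => (t - x) ^ (1 - μ)) t :=
        (continuousAt_const.sub continuousAt_id).rpow_const (Or.inr (by linarith))
      have h := this.tendsto.mono_left (nhdsWithin_le_nhds (s := Iio t))
      simpa [Real.zero_rpow (by linarith : 1 - μ ≠ 0)] using h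
    have := (hs.mul hp).neg
    rw [mul_zero, neg_zero] at this
    refine this.congr' ?_
    filter_upwards [hev] with x hx
    have hxt : 0 < t - x := by linarith [hx.2]
    have hxt' : x - t ≠ 0 := by linarith
    rw [slope_def_field, sub_eq_add_neg 1 μ, Real.rpow_add hxt, Real.rpow_one]
    field_simp
    ring
  refine le_of_tendsto_of_tendsto h1 h2 ?_
  filter_upwards [hev] with x hx using hf.integral_deriv_div_le hμ hx.1 hx.2 hmin

theorem deriv_nonpos_of_forall_le (hf : CaputoRegular f)
    {t : ℝ} (ht : 0 < t) (hmin : ∀ s ∈ Icc 0 t, f t ≤ f s) : deriv f t ≤ 0 := by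
  have hs : Tendsto (slope f t) (𝓝[<] t) (𝓝 (deriv f t)) :=
    (hasDerivAt_iff_tendsto_slope.1 (hf.hasDerivAt ht)).mono_left
      (nhdsWithin_mono _ fun x (hx : x < t) => hx.ne)
  refine le_of_tendsto hs ?_
  filter_upwards [Ioo_mem_nhdsLT ht] with x hx
  rw [slope_def_field]
  exact div_nonpos_of_nonneg_of_nonpos (by linarith [hmin x ⟨hx.1.le, hx.2.le⟩])
    (by linarith [hx.2])

/-- The extremum principle for the Caputo derivative. -/
theorem caputoDeriv_nonpos_of_forall_le (hf : CaputoRegular f) {μ : ℝ} (hμ : 0 < μ)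
    (hμ1 : μ ≤ 1) {t : ℝ} (ht : 0 < t) (hmin : ∀ s ∈ Icc 0 t, f t ≤ f s) :
    caputoDeriv μ f t ≤ 0 := by
  unfold caputoDeriv
  split_ifs with h
  · exact hf.deriv_nonpos_of_forall_le ht hmin
  · have hμ1' : μ < 1 := lt_of_le_of_ne hμ1 h
    exact mul_nonpos_of_nonneg_of_nonpos
      (one_div_nonneg.2 (Real.Gamma_pos_of_pos (by linarith)).le)
      (hf.integral_deriv_div_nonpos hμ hμ1' ht hmin)

/-- A comparison principle for fractional relaxation equations. -/
theorem nonneg_of_caputoDeriv_eq (hf : CaputoRegular f) {μ β lam : ℝ} (hμ : 0 < μ) (hμ1 : μ ≤ 1)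
    (hlam : 0 < lam)
    (heq : ∀ t, 0 < t → caputoDeriv μ f t = lam * t ^ β * (g t - f t))
    (hg : ∀ t, 0 < t → 0 ≤ g t) (h0 : 0 ≤ f 0) {t : ℝ} (ht : 0 ≤ t) : 0 ≤ f t := by
  by_contra! hneg
  obtain ⟨t₀, ht₀, hmin⟩ := isCompact_Icc.exists_isMinOn (nonempty_Icc.2 ht)
    (hf.continuousOn.mono Icc_subset_Ici_self)
  have hneg₀ : f t₀ < 0 := lt_of_le_of_lt (hmin (right_mem_Icc.2 ht)) hneg
  have hpos : 0 < t₀ := by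
    refine lt_of_le_of_ne ht₀.1 fun h => ?_
    rw [← h] at hneg₀
    linarith
  have h1 := hf.caputoDeriv_nonpos_of_forall_le hμ hμ1 hpos
    fun s hs => hmin ⟨hs.1, hs.2.trans ht₀.2⟩
  rw [heq t₀ hpos] at h1
  have h2 : 0 < lam * t₀ ^ β * (g t₀ - f t₀) :=
    mul_pos (mul_pos hlam (Real.rpow_pos_of_pos hpos β)) (by linarith [hg t₀ hpos])
  linarith

theorem eq_of_caputoDeriv_eq {u : ℝ → ℝ} (hf : CaputoRegular f) (hu : CaputoRegular u)
    {μ β lam : ℝ} (hμ : 0 < μ) (hμ1 : μ ≤ 1) (hlam : 0 < lam)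
    (hfeq : ∀ t, 0 < t → caputoDeriv μ f t = lam * t ^ β * (g t - f t))
    (hueq : ∀ t, 0 < t → caputoDeriv μ u t = lam * t ^ β * (g t - u t))
    (h0 : f 0 = u 0) {t : ℝ} (ht : 0 ≤ t) : f t = u t := by
  have h1 := (hf.sub hu).nonneg_of_caputoDeriv_eq (g := fun _ => 0) hμ hμ1 hlam
    (fun s hs => by rw [hf.caputoDeriv_sub hu hμ1 hs, hfeq s hs, hueq s hs]; ring)
    (fun _ _ => le_rfl) (by linarith) ht
  have h2 := (hu.sub hf).nonneg_of_caputoDeriv_eq (g := fun _ => 0) hμ hμ1 hlam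
    (fun s hs => by rw [hu.caputoDeriv_sub hf hμ1 hs, hfeq s hs, hueq s hs]; ring)
    (fun _ _ => le_rfl) (by linarith) ht
  linarith

end CaputoRegular
end

/-! ### Caputo derivatives of power series in `t ^ b`. -/

noncomputable section

open MeasureTheory Set Filter Topology

theorem contDiffOn_comp_rpow {h : ℝ → ℝ} {n : ℕ∞} (hh : ContDiff ℝ n h) (b : ℝ) :
    ContDiffOn ℝ n (fun t => h (t ^ b)) (Ioi 0) :=
  hh.comp_contDiffOn fun t (ht : 0 < t) =>
    (Real.contDiffAt_rpow_const_of_ne ht.ne').contDiffWithinAt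

theorem hasDerivAt_comp_rpow {h : ℝ → ℝ} (hh : Differentiable ℝ h) (b : ℝ) {t : ℝ} (ht : 0 < t) :
    HasDerivAt (fun t => h (t ^ b)) (deriv h (t ^ b) * (b * t ^ (b - 1))) t :=
  (hh (t ^ b)).hasDerivAt.comp t (Real.hasDerivAt_rpow_const (Or.inl ht.ne'))

theorem caputoRegular_comp_rpow {h : ℝ → ℝ} (hh : ContDiff ℝ 1 h) {b : ℝ} (hb : 0 < b) :
    CaputoRegular fun t => h (t ^ b) where
  continuousOn := (hh.continuous.comp (Real.continuous_rpow_const hb.le)).continuousOn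
  contDiffOn := contDiffOn_comp_rpow (n := 1) hh b
  integrable_deriv t ht := by
    have h1 : IntervalIntegrable (fun τ => b * τ ^ (b - 1)) volume 0 t :=
      (intervalIntegral.intervalIntegrable_rpow' (by linarith)).const_mul b
    have h2 : Continuous fun τ : ℝ => deriv h (τ ^ b) :=
      (hh.continuous_deriv le_rfl).comp (Real.continuous_rpow_const hb.le)
    refine (h1.continuousOn_mul h2.continuousOn).congr fun τ hτ => ?_
    rw [uIoc_of_le ht.le] at hτ
    exact (hasDerivAt_comp_rpow (hh.differentiable one_ne_zero) b hτ.1).deriv.symm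

theorem intervalIntegrable_rpow_div {μ p t : ℝ} (hμ1 : μ < 1) (hp : 0 < p) (ht : 0 < t) :
    IntervalIntegrable (fun τ => τ ^ (p - 1) / (t - τ) ^ μ) volume 0 t := by
  have h := ((caputoRegular_comp_rpow contDiff_id hp).intervalIntegrable_deriv_div
    hμ1 ht).const_mul p⁻¹
  refine h.congr fun τ hτ => ?_
  rw [uIoc_of_le ht.le] at hτ
  have hd := (hasDerivAt_comp_rpow differentiable_id p hτ.1).deriv
  simp only [id_eq, deriv_id', one_mul] at hd ⊢
  rw [hd]
  field_simp

/-- This is the scaled Beta integral with parameters `p` and `1 - μ`. -/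
theorem integral_rpow_div {μ p t : ℝ} (hμ1 : μ < 1) (hp : 0 < p) (ht : 0 < t) :
    ∫ τ in (0 : ℝ)..t, τ ^ (p - 1) / (t - τ) ^ μ =
      t ^ (p - μ) * (Real.Gamma p * Real.Gamma (1 - μ) / Real.Gamma (p + 1 - μ)) := by
  have key := Complex.betaIntegral_scaled p ((1 - μ : ℝ) : ℂ) ht
  rw [Complex.betaIntegral_eq_Gamma_mul_div _ _ (by simpa using hp) (by simpa using hμ1),
    ← Complex.ofReal_add, Complex.Gamma_ofReal, Complex.Gamma_ofReal, Complex.Gamma_ofReal] at key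
  have h1 : ∫ x in (0 : ℝ)..t, (x : ℂ) ^ ((p : ℂ) - 1) *
      ((t : ℂ) - x) ^ (((1 - μ : ℝ) : ℂ) - 1) =
      ((∫ τ in (0 : ℝ)..t, τ ^ (p - 1) / (t - τ) ^ μ : ℝ) : ℂ) := by
    rw [← intervalIntegral.integral_ofReal]
    refine intervalIntegral.integral_congr_ae (Eventually.of_forall fun τ hτ => ?_)
    rw [uIoc_of_le ht.le] at hτ
    have h2 : 0 ≤ t - τ := by linarith [hτ.2]
    rw [← Complex.ofReal_one, ← Complex.ofReal_sub, ← Complex.ofReal_sub, ← Complex.ofReal_sub,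
      ← Complex.ofReal_cpow hτ.1.le, ← Complex.ofReal_cpow h2, ← Complex.ofReal_mul,
      show 1 - μ - 1 = -μ by ring, Real.rpow_neg h2, div_eq_mul_inv]
  rw [h1, ← Complex.ofReal_one, ← Complex.ofReal_sub, ← Complex.ofReal_cpow ht.le,
    ← Complex.ofReal_mul, ← Complex.ofReal_div, ← Complex.ofReal_mul,
    Complex.ofReal_inj] at key
  rw [key, show p + (1 - μ) - 1 = p - μ by ring, show p + (1 - μ) = p + 1 - μ by ring]

namespace EntireCoeff

variable {a : ℕ → ℝ}

theorem caputoRegular_powerSum_rpow (ha : EntireCoeff a) {b : ℝ} (hb : 0 < b) :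
    CaputoRegular fun t => powerSum a (t ^ b) :=
  caputoRegular_comp_rpow (ha.contDiff_powerSum.of_le (by exact_mod_cast le_top)) hb

theorem deriv_powerSum_rpow (ha : EntireCoeff a) (b : ℝ) {t : ℝ} (ht : 0 < t) :
    deriv (fun t => powerSum a (t ^ b)) t =
      powerSum (fun k => ((k : ℝ) + 1) * a (k + 1)) (t ^ b) * (b * t ^ (b - 1)) := by
  rw [(hasDerivAt_comp_rpow (fun x => (ha.hasDerivAt_powerSum x).differentiableAt) b ht).deriv,
    ha.deriv_powerSum]

theorem rpow_mul_succ_sub {t : ℝ} (ht : 0 < t) (b c : ℝ) (k : ℕ) :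
    t ^ (b * (k + 1 : ℝ) - c) = t ^ (b - c) * (t ^ b) ^ k := by
  rw [← Real.rpow_natCast, ← Real.rpow_mul ht.le, ← Real.rpow_add ht]
  congr 1
  ring

/-- Termwise Caputo differentiation of a power series in `t ^ b`. -/
theorem caputoDeriv_powerSum_rpow (ha : EntireCoeff a) {μ b : ℝ} (hμ1 : μ ≤ 1)
    (hb : 0 < b)
    (hd : EntireCoeff fun k => a (k + 1) *
      (Real.Gamma (b * (k + 1 : ℝ) + 1) / Real.Gamma (b * (k + 1 : ℝ) + 1 - μ)))
    {t : ℝ} (ht : 0 < t) :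
    caputoDeriv μ (fun t => powerSum a (t ^ b)) t =
      t ^ (b - μ) * powerSum (fun k => a (k + 1) *
        (Real.Gamma (b * (k + 1 : ℝ) + 1) / Real.Gamma (b * (k + 1 : ℝ) + 1 - μ))) (t ^ b) := by
  have hbk : ∀ k : ℕ, 0 < b * (k + 1 : ℝ) := fun k => by positivity
  unfold caputoDeriv
  split_ifs with h
  -- For `μ = 1` the Gamma ratio collapses to `b * (k + 1)`, the ordinary power rule.
  · subst h
    rw [ha.deriv_powerSum_rpow b ht, mul_comm b, mul_left_comm]
    congr 1
    rw [mul_comm, powerSum, powerSum, ← tsum_mul_left]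
    refine tsum_congr fun k => ?_
    have hG := (Real.Gamma_pos_of_pos (hbk k)).ne'
    rw [add_sub_cancel_right, Real.Gamma_add_one (hbk k).ne', mul_div_cancel_right₀ _ hG]
    ring
  · have hμ : μ < 1 := lt_of_le_of_ne hμ1 h
    have hG1 : 0 < Real.Gamma (1 - μ) := Real.Gamma_pos_of_pos (by linarith)
    let F : ℕ → ℝ → ℝ := fun k τ =>
      a (k + 1) * (b * (k + 1 : ℝ)) * (τ ^ (b * (k + 1 : ℝ) - 1) / (t - τ) ^ μ)
    -- The constant `c` is free because both `a (k + 1)` (the value) and `|a (k + 1)|` (the norm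
    -- bound) are needed.
    have hval : ∀ (c : ℝ) (k : ℕ), c * (b * (k + 1 : ℝ)) *
        ∫ τ in Ioc 0 t, τ ^ (b * (k + 1 : ℝ) - 1) / (t - τ) ^ μ =
        Real.Gamma (1 - μ) * t ^ (b - μ) * (c * (Real.Gamma (b * (k + 1 : ℝ) + 1) /
          Real.Gamma (b * (k + 1 : ℝ) + 1 - μ)) * (t ^ b) ^ k) := by
      intro c k
      rw [← intervalIntegral.integral_of_le ht.le, integral_rpow_div hμ (hbk k) ht,
        Real.Gamma_add_one (hbk k).ne', rpow_mul_succ_sub ht]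
      ring
    have hFint : ∀ k, Integrable (F k) (volume.restrict (Ioc 0 t)) := fun k =>
      ((intervalIntegrable_iff_integrableOn_Ioc_of_le ht.le).1
        (intervalIntegrable_rpow_div hμ (hbk k) ht)).const_mul _
    have hnorm : ∀ k, ∫ τ in Ioc 0 t, ‖F k τ‖ = |a (k + 1)| * (b * (k + 1 : ℝ)) *
        ∫ τ in Ioc 0 t, τ ^ (b * (k + 1 : ℝ) - 1) / (t - τ) ^ μ := by
      intro k
      rw [← integral_const_mul]
      refine setIntegral_congr_fun measurableSet_Ioc fun τ hτ => ?_
      have h1 : 0 ≤ τ ^ (b * (k + 1 : ℝ) - 1) / (t - τ) ^ μ :=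
        div_nonneg (Real.rpow_nonneg hτ.1.le _) (Real.rpow_nonneg (by linarith [hτ.2]) _)
      simp only [F, Real.norm_eq_abs]
      rw [abs_mul, abs_mul, abs_of_pos (hbk k), abs_of_nonneg h1]
    have hsum : Summable fun k => ∫ τ in Ioc 0 t, ‖F k τ‖ := by
      refine ((hd (t ^ b) (by positivity)).mul_left
        (Real.Gamma (1 - μ) * t ^ (b - μ))).congr fun k => ?_
      have hpos : 0 < Real.Gamma (b * (k + 1 : ℝ) + 1) / Real.Gamma (b * (k + 1 : ℝ) + 1 - μ) :=
        div_pos (Real.Gamma_pos_of_pos (by linarith [hbk k]))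
          (Real.Gamma_pos_of_pos (by linarith [hbk k]))
      rw [hnorm, hval, abs_mul, abs_of_pos hpos]
    have key := (hasSum_integral_of_summable_integral_norm hFint hsum).tsum_eq
    have hR : ∫ τ in (0 : ℝ)..t, deriv (fun t => powerSum a (t ^ b)) τ / (t - τ) ^ μ =
        ∫ τ in Ioc 0 t, ∑' k, F k τ := by
      rw [intervalIntegral.integral_of_le ht.le]
      refine setIntegral_congr_fun measurableSet_Ioc fun τ hτ => ?_
      simp only [F]
      rw [ha.deriv_powerSum_rpow b hτ.1, powerSum, ← tsum_mul_right, ← tsum_div_const]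
      refine tsum_congr fun k => ?_
      rw [rpow_mul_succ_sub hτ.1]
      ring
    rw [hR, ← key]
    simp only [F, integral_const_mul, hval]
    rw [tsum_mul_left, powerSum]
    field_simp

end EntireCoeff
end

/-! ### The explicit solution, uniqueness and positivity. -/

noncomputable section

/-- The coefficients, as a power series in `x`, of `(lam x)^n / n! * E^(n)(-lam x)`, where `E` is
the power series with coefficients `c`. -/
def countingCoeff (c : ℕ → ℝ) (lam : ℝ) (n N : ℕ) : ℝ :=
  (-1) ^ (N + n) * (N.choose n : ℝ) * c N * lam ^ N

section

variable {c : ℕ → ℝ} {lam : ℝ}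

theorem EntireCoeff.countingCoeff (hc : EntireCoeff c) (lam : ℝ) (n : ℕ) :
    EntireCoeff (countingCoeff c lam n) := by
  refine hc.of_abs_le (C := 1) (r := 2 * |lam|) (by positivity) fun N => ?_
  have h : (N.choose n : ℝ) ≤ 2 ^ N := by exact_mod_cast Nat.choose_le_two_pow N n
  rw [_root_.countingCoeff, abs_mul, abs_mul, abs_mul, abs_pow, abs_pow, abs_neg, abs_one,
    one_pow, Nat.abs_cast, mul_pow]
  calc 1 * (N.choose n : ℝ) * |c N| * |lam| ^ N ≤ 1 * 2 ^ N * |c N| * |lam| ^ N := by gcongr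
    _ = _ := by ring

theorem powerSum_countingCoeff (hc : EntireCoeff c) (lam : ℝ) (n : ℕ) (x : ℝ) :
    powerSum (countingCoeff c lam n) x = (lam * x) ^ n / (n.factorial : ℝ) *
      ∑' m : ℕ, ((m + n).factorial : ℝ) / (m.factorial : ℝ) * c (m + n) * (-(lam * x)) ^ m := by
  rw [powerSum, ← ((hc.countingCoeff lam n).summable x).sum_add_tsum_nat_add n,
    -- The terms `N < n` vanish with `N.choose n`; the rest are reindexed by `N = m + n`.
    Finset.sum_eq_zero fun N hN => ?_, zero_add, ← tsum_mul_left]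
  · refine tsum_congr fun m => ?_
    rw [countingCoeff, ← Nat.choose_symm_add, Nat.cast_add_choose, add_assoc, pow_add, ← two_mul, pow_mul (-1 : ℝ) 2 n,
      neg_one_sq, one_pow, neg_pow (lam * x)]
    field_simp
    ring
  · rw [countingCoeff, Nat.choose_eq_zero_of_lt (Finset.mem_range.1 hN)]
    simp

theorem powerSum_countingCoeff_eq_iteratedDeriv (hc : EntireCoeff c) (lam : ℝ) (n : ℕ) (x : ℝ) :
    powerSum (countingCoeff c lam n) x = (lam * x) ^ n / (n.factorial : ℝ) *
      iteratedDeriv n (powerSum c) (-(lam * x)) := by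
  rw [powerSum_countingCoeff hc, EntireCoeff.iteratedDeriv_powerSum n hc, powerSum]

/-- Taylor expansion at `-(lam * x)` with increment `s * (lam * x)`. -/
theorem hasSum_pow_mul_powerSum_countingCoeff (hc : EntireCoeff c) (lam x s : ℝ) :
    HasSum (fun n : ℕ => s ^ n * powerSum (countingCoeff c lam n) x)
      (powerSum c (lam * x * (s - 1))) := by
  convert hc.hasSum_taylor (-(lam * x)) (s * (lam * x)) using 1
  · funext n
    rw [powerSum_countingCoeff hc, mul_pow]
    ring
  · congr 1
    ring

theorem powerSum_sub {a a' : ℕ → ℝ} (ha : EntireCoeff a) (ha' : EntireCoeff a') (r x : ℝ) :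
    powerSum (fun k => r * (a k - a' k)) x = r * (powerSum a x - powerSum a' x) := by
  rw [powerSum, powerSum, powerSum, ← (ha.summable x).tsum_sub (ha'.summable x), ← tsum_mul_left]
  exact tsum_congr fun k => by ring

end

theorem kilbasSaigo_eq_powerSum (α m l : ℝ) :
    (fun x : ℝ => kilbasSaigo α m l x) = powerSum (kilbasSaigoCoeff α m l) := by
  funext x
  simp [kilbasSaigo, powerSum]

section Solution

variable {μ β lam : ℝ}

/-- The explicit solution of the counting system. -/
def countingSolution (μ β lam : ℝ) (n : ℕ) (t : ℝ) : ℝ :=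
  powerSum (countingCoeff (kilbasSaigoCoeff μ (1 + β / μ) (β / μ)) lam n) (t ^ (μ + β))

theorem countingCoeff_succ_mul_gamma_ratio (hμ : 0 < μ) (hμ1 : μ ≤ 1) (hβ : -μ < β) (n k : ℕ) :
    countingCoeff (kilbasSaigoCoeff μ (1 + β / μ) (β / μ)) lam n (k + 1) *
      (Real.Gamma ((μ + β) * (k + 1 : ℝ) + 1) / Real.Gamma ((μ + β) * (k + 1 : ℝ) + 1 - μ)) =
    (-1) ^ (k + 1 + n) * ((k + 1).choose n : ℝ) *
      kilbasSaigoCoeff μ (1 + β / μ) (β / μ) k * lam ^ (k + 1) := by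
  have hk : 0 < (μ + β) * (k + 1 : ℝ) := mul_pos (by linarith) (by positivity)
  have h1 := (Real.Gamma_pos_of_pos (by linarith : 0 < (μ + β) * (k + 1 : ℝ) + 1)).ne'
  have h2 := (Real.Gamma_pos_of_pos (by linarith : 0 < (μ + β) * (k + 1 : ℝ) + 1 - μ)).ne'
  rw [countingCoeff, kilbasSaigoCoeff_succ hμ.ne']
  generalize kilbasSaigoCoeff μ (1 + β / μ) (β / μ) k = c
  field_simp

theorem caputoDeriv_countingSolution (hμ : 0 < μ) (hμ1 : μ ≤ 1) (hβ : -μ < β) {n : ℕ}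
    {d : ℕ → ℝ} (hd : EntireCoeff d)
    (h : ∀ k, (-1) ^ (k + 1 + n) * ((k + 1).choose n : ℝ) *
      kilbasSaigoCoeff μ (1 + β / μ) (β / μ) k * lam ^ (k + 1) = d k) {t : ℝ} (ht : 0 < t) :
    caputoDeriv μ (countingSolution μ β lam n) t = t ^ β * powerSum d (t ^ (μ + β)) := by
  have hc := entireCoeff_kilbasSaigoCoeff hμ hμ1 hβ
  have hfun : (fun k : ℕ => countingCoeff (kilbasSaigoCoeff μ (1 + β / μ) (β / μ)) lam n (k + 1) *
      (Real.Gamma ((μ + β) * (k + 1 : ℝ) + 1) / Real.Gamma ((μ + β) * (k + 1 : ℝ) + 1 - μ))) = d :=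
    funext fun k => (countingCoeff_succ_mul_gamma_ratio hμ hμ1 hβ n k).trans (h k)
  have key := (hc.countingCoeff lam n).caputoDeriv_powerSum_rpow hμ1 (by linarith : 0 < μ + β)
    (by rwa [hfun]) ht
  rw [hfun, add_sub_cancel_left] at key
  exact key

theorem caputoDeriv_countingSolution_zero (hμ : 0 < μ) (hμ1 : μ ≤ 1) (hβ : -μ < β)
    {t : ℝ} (ht : 0 < t) :
    caputoDeriv μ (countingSolution μ β lam 0) t =
      lam * t ^ β * (0 - countingSolution μ β lam 0 t) := by
  have hc := (entireCoeff_kilbasSaigoCoeff hμ hμ1 hβ).countingCoeff lam 0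
  have h0 : EntireCoeff fun _ => 0 := fun x _ => by simp
  have hz (x : ℝ) : powerSum (fun _ => 0) x = 0 := by simp [powerSum]
  rw [caputoDeriv_countingSolution hμ hμ1 hβ (n := 0) (d := fun k => lam * (0 -
    countingCoeff (kilbasSaigoCoeff μ (1 + β / μ) (β / μ)) lam 0 k)) ?_ (fun k => ?_) ht,
    powerSum_sub h0 hc, hz, countingSolution]
  · ring
  · refine hc.of_abs_le (C := |lam|) (r := 1) zero_le_one fun k => ?_
    rw [zero_sub, abs_mul, abs_neg, one_pow, mul_one]
  · rw [countingCoeff]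
    simp only [Nat.choose_zero_right]
    ring

theorem caputoDeriv_countingSolution_succ (hμ : 0 < μ) (hμ1 : μ ≤ 1) (hβ : -μ < β) (n : ℕ)
    {t : ℝ} (ht : 0 < t) :
    caputoDeriv μ (countingSolution μ β lam (n + 1)) t =
      lam * t ^ β * (countingSolution μ β lam n t - countingSolution μ β lam (n + 1) t) := by
  have hc := entireCoeff_kilbasSaigoCoeff hμ hμ1 hβ
  have h1 := hc.countingCoeff lam n
  have h2 := hc.countingCoeff lam (n + 1)
  rw [caputoDeriv_countingSolution hμ hμ1 hβ (n := n + 1) (d := fun k => lam *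
    (countingCoeff (kilbasSaigoCoeff μ (1 + β / μ) (β / μ)) lam n k -
    countingCoeff (kilbasSaigoCoeff μ (1 + β / μ) (β / μ)) lam (n + 1) k)) ?_ (fun k => ?_) ht,
    powerSum_sub h1 h2, countingSolution, countingSolution]
  · ring
  · intro x hx
    refine Summable.of_nonneg_of_le (fun k => by positivity) (fun k => ?_)
      (((h1 x hx).add (h2 x hx)).mul_left |lam|)
    rw [abs_mul, mul_assoc, ← add_mul]
    gcongr
    exact abs_sub _ _
  -- Pascal's rule; the alternating sign turns its sum into the difference in the equation.
  · rw [countingCoeff, countingCoeff, Nat.choose_succ_succ]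
    push_cast
    ring

theorem countingSolution_zero (hμβ : 0 < μ + β) (n : ℕ) :
    countingSolution μ β lam n 0 = if n = 0 then 1 else 0 := by
  rw [countingSolution, Real.zero_rpow hμβ.ne', EntireCoeff.powerSum_zero, countingCoeff]
  rcases n with _ | n
  · simp [kilbasSaigoCoeff_zero]
  · simp

theorem isCountingSolution_countingSolution (hμ : 0 < μ) (hμ1 : μ ≤ 1) (hβ : -μ < β) :
    IsCountingSolution μ β lam (countingSolution μ β lam) where
  regular n := ((entireCoeff_kilbasSaigoCoeff hμ hμ1 hβ).countingCoeff lam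
    n).caputoRegular_powerSum_rpow (by linarith)
  eq_zero t ht := by rw [caputoDeriv_countingSolution_zero hμ hμ1 hβ ht]; ring
  eq_succ n t ht := caputoDeriv_countingSolution_succ hμ hμ1 hβ n ht
  init n := countingSolution_zero (by linarith) n

theorem IsCountingSolution.nonneg {P : ℕ → ℝ → ℝ} (hP : IsCountingSolution μ β lam P)
    (hμ : 0 < μ) (hμ1 : μ ≤ 1) (hlam : 0 < lam) (n : ℕ) {t : ℝ} (ht : 0 ≤ t) : 0 ≤ P n t := by
  have h0 (n : ℕ) : 0 ≤ P n 0 := by rw [hP.init]; split_ifs <;> norm_num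
  induction n generalizing t with
  | zero =>
    exact (hP.regular 0).nonneg_of_caputoDeriv_eq (g := fun _ => 0) hμ hμ1 hlam
      (fun s hs => by rw [hP.eq_zero s hs]; ring) (fun _ _ => le_rfl) (h0 0) ht
  | succ n ih =>
    exact (hP.regular (n + 1)).nonneg_of_caputoDeriv_eq (g := P n) hμ hμ1 hlam
      (hP.eq_succ n) (fun s hs => ih hs.le) (h0 _) ht

theorem IsCountingSolution.unique {P Q : ℕ → ℝ → ℝ} (hP : IsCountingSolution μ β lam P)
    (hQ : IsCountingSolution μ β lam Q) (hμ : 0 < μ) (hμ1 : μ ≤ 1) (hlam : 0 < lam) (n : ℕ)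
    {t : ℝ} (ht : 0 ≤ t) : P n t = Q n t := by
  have h0 (n : ℕ) : P n 0 = Q n 0 := by rw [hP.init, hQ.init]
  induction n generalizing t with
  | zero =>
    exact (hP.regular 0).eq_of_caputoDeriv_eq (g := fun _ => 0) (hQ.regular 0) hμ hμ1 hlam
      (fun s hs => by rw [hP.eq_zero s hs]; ring) (fun s hs => by rw [hQ.eq_zero s hs]; ring)
      (h0 0) ht
  | succ n ih =>
    exact (hP.regular (n + 1)).eq_of_caputoDeriv_eq (g := P n) (hQ.regular (n + 1)) hμ hμ1 hlam
      (hP.eq_succ n) (fun s hs => by rw [hQ.eq_succ n s hs, ih hs.le]) (h0 _) ht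

theorem iteratedDeriv_powerSum_kilbasSaigoCoeff_nonneg (hμ : 0 < μ) (hμ1 : μ ≤ 1) (hβ : -μ < β)
    (n : ℕ) {x : ℝ} (hx : 0 ≤ x) :
    0 ≤ iteratedDeriv n (powerSum (kilbasSaigoCoeff μ (1 + β / μ) (β / μ))) (-x) := by
  have hc := entireCoeff_kilbasSaigoCoeff hμ hμ1 hβ
  rcases hx.eq_or_lt with rfl | hx
  · rw [neg_zero, EntireCoeff.iteratedDeriv_powerSum n hc, EntireCoeff.powerSum_zero]
    have := kilbasSaigoCoeff_pos hμ hμ1 hβ (0 + n)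
    positivity
  · have hb : μ + β ≠ 0 := by linarith
    -- This time is chosen so that `t ^ (μ + β) = x`; the factor `x ^ n / n!` is then divided out.
    have h := (isCountingSolution_countingSolution (lam := 1) hμ hμ1 hβ).nonneg hμ hμ1 one_pos n
      (t := x ^ (μ + β)⁻¹) (by positivity)
    rw [countingSolution, powerSum_countingCoeff_eq_iteratedDeriv hc, one_mul, ← Real.rpow_mul hx.le,
      inv_mul_cancel₀ hb, Real.rpow_one] at h
    exact nonneg_of_mul_nonneg_right h (by positivity)

end Solution

end

/-! ### Assembly. -/

theorem mainTheorem2 (μ β lam : ℝ) (hμ : 0 < μ) (hμ1 : μ ≤ 1) (hβ : -μ < β) (hβ1 : β ≤ 1 - μ)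
    (hlam : 0 < lam) :
    -- the Kilbas–Saigo series converges on the whole complex plane; its sum is smooth
    (∀ z : ℂ, Summable fun n : ℕ => (kilbasSaigoCoeff μ (1 + β / μ) (β / μ) n : ℂ) * z ^ n) ∧
    ContDiff ℝ ∞ (fun x : ℝ => kilbasSaigo μ (1 + β / μ) (β / μ) x) ∧
    -- complete monotonicity
    (∀ (n : ℕ) (x : ℝ), 0 ≤ x →
      0 ≤ (-1) ^ n * iteratedDeriv n (fun y : ℝ => kilbasSaigo μ (1 + β / μ) (β / μ) (-y)) x) ∧
    -- the system has a solution, and every solution is given by the formulas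
    (∃ P : ℕ → ℝ → ℝ, IsCountingSolution μ β lam P) ∧
    (∀ P : ℕ → ℝ → ℝ, IsCountingSolution μ β lam P → ∀ t : ℝ, 0 ≤ t →
      -- generating function
      (∀ s : ℝ, HasSum (fun n : ℕ => s ^ n * P n t)
        (kilbasSaigo μ (1 + β / μ) (β / μ) (lam * t ^ (μ + β) * (s - 1)))) ∧
      (∀ n : ℕ, P n t =
        1 / (n.factorial : ℝ) * iteratedDeriv n (fun s : ℝ => ∑' k : ℕ, s ^ k * P k t) 0) ∧
      -- derivative form
      (∀ n : ℕ, P n t = (lam * t ^ (μ + β)) ^ n / (n.factorial : ℝ) *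
        iteratedDeriv n (fun x : ℝ => kilbasSaigo μ (1 + β / μ) (β / μ) x)
          (-(lam * t ^ (μ + β)))) ∧
      (∀ (n : ℕ) (z : ℝ), z = -(lam * t ^ (μ + β)) → P n t = (-z) ^ n / (n.factorial : ℝ) *
        iteratedDeriv n (fun x : ℝ => kilbasSaigo μ (1 + β / μ) (β / μ) x) z) ∧
      -- series form
      (∀ n : ℕ,
        (Summable fun m : ℕ => ((m + n).factorial : ℝ) / (m.factorial : ℝ) *
          (-(lam * t ^ (μ + β))) ^ m *
          ∏ k ∈ Finset.range (m + n),
            Real.Gamma (μ * (k * (1 + β / μ) + β / μ) + 1) /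
              Real.Gamma (μ * (k * (1 + β / μ) + β / μ + 1) + 1)) ∧
        P n t = (lam * t ^ (μ + β)) ^ n / (n.factorial : ℝ) *
          ∑' m : ℕ, ((m + n).factorial : ℝ) / (m.factorial : ℝ) *
            (-(lam * t ^ (μ + β))) ^ m *
            ∏ k ∈ Finset.range (m + n),
              Real.Gamma (μ * (k * (1 + β / μ) + β / μ) + 1) /
                Real.Gamma (μ * (k * (1 + β / μ) + β / μ + 1) + 1)) ∧
      -- probability distribution
      (∀ n : ℕ, 0 ≤ P n t) ∧
      HasSum (fun n : ℕ => P n t) 1) := by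
  have hc := entireCoeff_kilbasSaigoCoeff hμ hμ1 hβ
  have hE := kilbasSaigo_eq_powerSum μ (1 + β / μ) (β / μ)
  have hQ : IsCountingSolution μ β lam (countingSolution μ β lam) :=
    isCountingSolution_countingSolution hμ hμ1 hβ
  refine ⟨fun z => ?_, hE ▸ hc.contDiff_powerSum, fun n x hx => ?_, ⟨_, hQ⟩, fun P hP t ht => ?_⟩
  · refine Summable.of_norm ((hc ‖z‖ (norm_nonneg z)).congr fun n => ?_)
    rw [norm_mul, norm_pow, Complex.norm_real, Real.norm_eq_abs]
  · have h := iteratedDeriv_comp_neg n (fun x : ℝ => kilbasSaigo μ (1 + β / μ) (β / μ) x) x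
    rw [h, smul_eq_mul, ← mul_assoc, ← mul_pow, neg_one_mul, neg_neg, one_pow, one_mul, hE]
    exact iteratedDeriv_powerSum_kilbasSaigoCoeff_nonneg hμ hμ1 hβ n hx
  have hPQ (n : ℕ) : P n t = powerSum (countingCoeff
      (kilbasSaigoCoeff μ (1 + β / μ) (β / μ)) lam n) (t ^ (μ + β)) :=
    hP.unique hQ hμ hμ1 hlam n ht
  have hG (s : ℝ) : HasSum (fun n : ℕ => s ^ n * P n t)
      (kilbasSaigo μ (1 + β / μ) (β / μ) (lam * t ^ (μ + β) * (s - 1))) := by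
    simp only [hPQ]
    rw [congrFun hE]
    exact hasSum_pow_mul_powerSum_countingCoeff hc lam _ s
  have hpos (n : ℕ) : 0 ≤ P n t := hP.nonneg hμ hμ1 hlam n ht
  have hder (n : ℕ) : P n t = (lam * t ^ (μ + β)) ^ n / (n.factorial : ℝ) *
      iteratedDeriv n (fun x : ℝ => kilbasSaigo μ (1 + β / μ) (β / μ) x)
        (-(lam * t ^ (μ + β))) := by
    rw [hPQ, hE, powerSum_countingCoeff_eq_iteratedDeriv hc]
  refine ⟨hG, fun n => ?_, hder, ?_, fun n => ⟨?_, ?_⟩, hpos, ?_⟩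
  -- Since `P k t ≥ 0`, convergence for `s ≥ 0` is absolute, so the generating function is an entire
  -- power series in `s` and its coefficients are read off at `0`.
  · have hPt : EntireCoeff fun k => P k t := fun x _ =>
      (hG x).summable.congr fun k => by rw [abs_of_nonneg (hpos k), mul_comm]
    have hfun : (fun s : ℝ => ∑' k : ℕ, s ^ k * P k t) = powerSum fun k => P k t :=
      funext fun s => tsum_congr fun k => mul_comm _ _
    rw [hfun, EntireCoeff.iteratedDeriv_powerSum n hPt, EntireCoeff.powerSum_zero]
    simp only [zero_add, Nat.factorial_zero, Nat.cast_one, div_one]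
    field_simp
  · rintro n z rfl
    rw [neg_neg]
    exact hder n
  · refine ((hc.iterate_derivCoeff n).summable (-(lam * t ^ (μ + β)))).congr fun m => ?_
    exact mul_right_comm _ _ _
  · rw [hPQ, powerSum_countingCoeff hc]
    congr 1
    exact tsum_congr fun m => mul_right_comm _ _ _
  · have h := hG 1
    rw [sub_self, mul_zero, congrFun hE, EntireCoeff.powerSum_zero, kilbasSaigoCoeff_zero] at h
    simpa using h
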